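/- Let $\omega:[0,\infty)\to[0,\infty)$ be a continuous, increasing, subadditive function with $\omega(0)=0$ such that $\log(1+t)\le c\,\omega(t)$ for all $t>1$ and some constant $c>0$, and $\int_0^\infty \frac{\omega(t)}{1+t^2}\,dt<\infty$. Let $p(z)=|\operatorname{Im} z|+\omega(|z|)$ for $z\in\mathbb C$, and let $A_p$ be the algebra of all entire functions $f$ for which there are $A,B>0$ with $\log|f(z)|\le A+B\,p(z)$ for all $z\in\mathbb C$. Let $\Lambda\subset\mathbb C$ be a discrete set with $\Lambda\cap\mathbb R=\emptyset$, let $m_\lambda\ge 1$ be an integer for each $\lambda\in\Lambda$, and suppose that $X=\{(\lambda,m_\lambda)\}_{\lambda\in\Lambda}$ is $A_p$-interpolating, that is: for all complex values $\{v_\lambda^l\}$, $\lambda\in\Lambda$, $0\le l\le m_\lambda-1$, with $$\sup_{\lambda\in\Lambda}\Bigl(\sum_{l=0}^{m_\lambda-1}|v_\lambda^l|\Bigr)e^{-\alpha p(\lambda)}<\infty\quad\text{for some }\alpha>0,$$ there exists $f\in A_p$ such that $f^{(l)}(\lambda)/l!=v_\lambda^l$ for all $\lambda\in\Lambda$ and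 $0\le l\le m_\lambda-1$. Let $\mathbb H=\{z\in\mathbb C:\operatorname{Im} z>0\}$. Then there exists a constant $C>0$ such that $$\sum_{\lambda'\in\Lambda\cap\mathbb H,\ \lambda'\ne\lambda} m_{\lambda'}\log\Bigl|\frac{\lambda-\lambda'}{\lambda-\bar\lambda'}\Bigr|^{-1}\le C\,p(\lambda)\qquad\text{for all }\lambda\in\Lambda\cap\mathbb H$$ (in particular each of these sums, whose terms are nonnegative, converges). -/

import Mathlib

/-- `ω : [0,∞) → [0,∞)` (given as a real function, only its values on `[0,∞)` matter) is the
radial part of a Beurling weight: it is continuous, increasing, subadditive, normalized by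
`ω 0 = 0`, it dominates `log (1 + t)` for `t > 1`, and `∫₀^∞ ω(t) / (1 + t²) dt` converges. -/
structure IsBeurlingFunction (ω : ℝ → ℝ) : Prop where
  nonneg : ∀ t, 0 ≤ t → 0 ≤ ω t
  continuousOn : ContinuousOn ω (Set.Ici 0)
  monotoneOn : MonotoneOn ω (Set.Ici 0)
  subadditive : ∀ s t, 0 ≤ s → 0 ≤ t → ω (s + t) ≤ ω s + ω t
  map_zero : ω 0 = 0
  log_le : ∃ c : ℝ, 0 < c ∧ ∀ t, 1 < t → Real.log (1 + t) ≤ c * ω t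
  integrable : MeasureTheory.IntegrableOn (fun t => ω t / (1 + t ^ 2)) (Set.Ioi 0)

/-- The Beurling weight `p(z) = |Im z| + ω(|z|)`. -/
noncomputable def beurlingWeight (ω : ℝ → ℝ) (z : ℂ) : ℝ :=
  |z.im| + ω ‖z‖

/-- The algebra `A_p`: the entire functions `f` with `log |f(z)| ≤ A + B p(z)` for some
`A, B > 0`. The inequality is written in exponentiated form, so that nothing is required at the
zeros of `f`. -/
def weightedAlgebra (p : ℂ → ℝ) : Set (ℂ → ℂ) :=
  {f | Differentiable ℂ f ∧
    ∃ A B : ℝ, 0 < A ∧ 0 < B ∧ ∀ z, ‖f z‖ ≤ Real.exp (A + B * p z)}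

/-- A variety `X = {(a, m_a)}_{a ∈ Λ}`: a discrete set `Λ` of points of the plane, each with a
multiplicity `m_a ≥ 1`. -/
structure Variety where
  points : Set ℂ
  discrete : IsDiscrete points
  mult : points → ℕ
  one_le_mult : ∀ a, 1 ≤ mult a

/-- The variety `X` is `A_p`-interpolating: all values `v a l` (`a ∈ Λ`, `0 ≤ l < m_a`) with
`sup_a (∑_{l < m_a} |v a l|) e^{-α p(a)} < ∞` for some `α > 0` are the Taylor coefficients
`f^{(l)}(a) / l!` of some `f ∈ A_p`. -/
def Variety.IsInterpolating (X : Variety) (p : ℂ → ℝ) : Prop :=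
  ∀ v : X.points → ℕ → ℂ,
    (∃ α : ℝ, 0 < α ∧ BddAbove (Set.range fun a : X.points =>
      (∑ l ∈ Finset.range (X.mult a), ‖v a l‖) * Real.exp (-α * p a))) →
    ∃ f ∈ weightedAlgebra p, ∀ a : X.points, ∀ l < X.mult a,
      iteratedDeriv l f a / (l.factorial : ℂ) = v a l

/-- The Green function `log |(z - w) / (z - w̄)|⁻¹` of the upper half-plane. -/
noncomputable def greenUpperHalfPlane (z w : ℂ) : ℝ :=
  Real.log (‖(z - w) / (z - starRingEnd ℂ w)‖⁻¹)

open Filter Topology Metric Set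


/-! For `a ∈ Λ ∩ ℍ` take a peak function: `f ∈ A_p` with `f a = 1` that vanishes on the rest of `Λ`
with multiplicities. A Baire category argument makes its growth constant `C` independent of `a`
(`Variety.IsInterpolating.exists_uniform_isPeak`).

Let `φ` be the conformal map of the disc onto `ℍ` with `φ 0 = a`. Jensen's formula for `f ∘ φ` on
`|w| < r`, as `r → 1`, bounds the Green sum at `a` by the means of `log |f ∘ φ|`, hence by `C + C ·
mean(p ∘ φ)` (`sum_mul_greenUpperHalfPlane_le`).

These means are at most `K (1 + p a)` (`IsBeurlingFunction.exists_circleAverage_le`): `Im φ` is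
harmonic and positive, with mean `Im a`; and `|φ|` is at most `|a|` plus a multiple of `Im a` over
the angular distance `θ` to the pole, so subadditivity leaves `∫ ω(1/θ) dθ`, finite by the integral
condition.

The additive constant is absorbed because `p` is bounded below on `Λ`: neither is `0` in `Λ` nor
does `Λ` accumulate there. -/

/-! ### Normal families of entire functions -/

theorem equicontinuous_of_differentiable_of_norm_le {ι : Type*} {F : ι → ℂ → ℂ} {M : ℂ → ℝ}
    (hM : Continuous M) (hd : ∀ i, Differentiable ℂ (F i)) (hb : ∀ i z, ‖F i z‖ ≤ M z) :
    Equicontinuous F := by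
  intro x
  obtain ⟨C, hC⟩ := (isCompact_closedBall x 1).exists_bound_of_continuousOn hM.continuousOn
  have hC' : ∀ i, ∀ z ∈ ball x 1, ‖F i z‖ ≤ C := fun i z hz =>
    (hb i z).trans ((le_abs_self _).trans (hC z (ball_subset_closedBall hz)))
  refine equicontinuousAt_of_continuity_modulus (fun z => 2 * C / 1 * dist z x) ?_ F ?_
  · have : Continuous fun z => 2 * C / 1 * dist z x := by fun_prop
    simpa using this.tendsto x
  · filter_upwards [ball_mem_nhds x one_pos] with z hz i
    rw [dist_comm]
    refine Complex.dist_le_div_mul_dist_of_mapsTo_ball (hd i).differentiableOn (fun u hu => ?_) hz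
    rw [mem_closedBall, dist_eq_norm]
    calc ‖F i u - F i x‖ ≤ ‖F i u‖ + ‖F i x‖ := norm_sub_le _ _
      _ ≤ 2 * C := by linarith [hC' i u hu, hC' i x (mem_ball_self one_pos)]

/-- Ascoli: on an equicontinuous family, pointwise convergence is uniform on compact sets. The
filter is arbitrary because the pointwise topology on `ℂ → ℂ` is not first countable. -/
theorem tendstoLocallyUniformlyOn_of_tendsto_of_norm_le {ι : Type*} {F : ι → ℂ → ℂ} {M : ℂ → ℝ}
    (hM : Continuous M) (hd : ∀ i, Differentiable ℂ (F i)) (hb : ∀ i z, ‖F i z‖ ≤ M z)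
    {l : Filter ι} {g : ℂ → ℂ} (h : Tendsto F l (𝓝 g)) :
    TendstoLocallyUniformlyOn F g l univ := by
  have hF := equicontinuous_of_differentiable_of_norm_le hM hd hb
  rw [tendstoLocallyUniformlyOn_iff_forall_isCompact isOpen_univ]
  intro K _ hK
  have hcov : ⋃₀ {K : Set ℂ | IsCompact K} = univ :=
    eq_univ_of_forall fun z => ⟨{z}, isCompact_singleton, rfl⟩
  have h' := (EquicontinuousOn.tendsto_uniformOnFun_iff_pi (𝔖 := {K : Set ℂ | IsCompact K})
    (fun _ h => h) hcov (fun K _ => hF.equicontinuousOn K) l g).2 h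
  exact UniformOnFun.tendsto_iff_tendstoUniformlyOn.1 h' K hK

theorem TendstoLocallyUniformlyOn.iteratedDeriv_univ {ι : Type*} {F : ι → ℂ → ℂ}
    (hd : ∀ i, Differentiable ℂ (F i)) {l : Filter ι} {g : ℂ → ℂ}
    (h : TendstoLocallyUniformlyOn F g l univ) (k : ℕ) :
    TendstoLocallyUniformlyOn (fun i => iteratedDeriv k (F i)) (iteratedDeriv k g) l univ := by
  induction k with
  | zero => simpa using h
  | succ k ih =>
    simp_rw [iteratedDeriv_succ]
    refine ih.deriv (Eventually.of_forall fun i => ?_) isOpen_univ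
    exact ((hd i).contDiff.differentiable_iteratedDeriv k (WithTop.coe_lt_top _)).differentiableOn

theorem isClosed_setOf_differentiable_norm_le_iteratedDeriv_eq_zero {M : ℂ → ℝ}
    (hM : Continuous M) (T : Set (ℂ × ℕ)) :
    IsClosed {f : ℂ → ℂ | Differentiable ℂ f ∧ (∀ z, ‖f z‖ ≤ M z) ∧
      ∀ t ∈ T, iteratedDeriv t.2 f t.1 = 0} := by
  set S := {f : ℂ → ℂ | Differentiable ℂ f ∧ (∀ z, ‖f z‖ ≤ M z) ∧
      ∀ t ∈ T, iteratedDeriv t.2 f t.1 = 0}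
  rw [isClosed_iff_clusterPt]
  intro g hg
  have : (comap ((↑) : S → ℂ → ℂ) (𝓝 g)).NeBot := by
    rw [comap_neBot_iff]
    intro t ht
    rw [← mem_closure_iff_clusterPt, mem_closure_iff_nhds] at hg
    obtain ⟨f, hft, hfS⟩ := hg t ht
    exact ⟨⟨f, hfS⟩, hft⟩
  have hlim : Tendsto ((↑) : S → ℂ → ℂ) (comap (↑) (𝓝 g)) (𝓝 g) := tendsto_comap
  have hu := tendstoLocallyUniformlyOn_of_tendsto_of_norm_le hM (fun f : S => f.2.1)
    (fun f => f.2.2.1) hlim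
  refine ⟨differentiableOn_univ.1 (hu.differentiableOn
    (Eventually.of_forall fun f => f.2.1.differentiableOn) isOpen_univ), fun z => ?_,
    fun t ht => ?_⟩
  · exact le_of_tendsto ((tendsto_pi_nhds.1 hlim z).norm)
      (Eventually.of_forall fun f => f.2.2.1 z)
  · refine tendsto_nhds_unique
      ((hu.iteratedDeriv_univ (fun f : S => f.2.1) t.2).tendsto_at (mem_univ t.1)) ?_
    simp only [fun f : S => f.2.2.2 t ht]
    exact tendsto_const_nhds

/-- Montel in the pointwise topology: a closed subset of a product of closed discs, compact by
Tychonoff. -/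
theorem isCompact_setOf_differentiable_norm_le_iteratedDeriv_eq_zero {M : ℂ → ℝ}
    (hM : Continuous M) (T : Set (ℂ × ℕ)) :
    IsCompact {f : ℂ → ℂ | Differentiable ℂ f ∧ (∀ z, ‖f z‖ ≤ M z) ∧
      ∀ t ∈ T, iteratedDeriv t.2 f t.1 = 0} := by
  refine (isCompact_univ_pi fun z => isCompact_closedBall (0 : ℂ) (M z)).of_isClosed_subset
    (isClosed_setOf_differentiable_norm_le_iteratedDeriv_eq_zero hM T) fun f hf z _ => ?_
  simpa using hf.2.1 z

/-! ### Uniform peak functions by Baire category -/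

/-- Values bounded by `1` in order zero, and zero in the higher orders, are interpolated. -/
theorem Variety.IsInterpolating.exists_of_norm_le_one {X : Variety} {p : ℂ → ℝ}
    (hX : X.IsInterpolating p) (hp0 : ∀ z, 0 ≤ p z) (v : X.points → ℂ) (hv : ∀ a, ‖v a‖ ≤ 1) :
    ∃ f ∈ weightedAlgebra p, ∀ a : X.points, f a = v a ∧
      ∀ l, 1 ≤ l → l < X.mult a → iteratedDeriv l f a = 0 := by
  obtain ⟨f, hf, hfv⟩ := hX (fun a l => if l = 0 then v a else 0) ⟨1, one_pos, 1, by
    rintro _ ⟨a, rfl⟩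
    have h0 : ∑ l ∈ Finset.range (X.mult a), ‖(if l = 0 then v a else 0 : ℂ)‖ ≤ 1 := by
      rw [Finset.sum_eq_single 0]
      · simpa using hv a
      · intro l _ hl; simp [hl]
      · intro h; exact absurd (X.one_le_mult a) (by simpa using h)
    have h1 : Real.exp (-1 * p a) ≤ 1 := Real.exp_le_one_iff.2 (by linarith [hp0 a])
    exact mul_le_one₀ h0 (Real.exp_pos _).le h1⟩
  refine ⟨f, hf, fun a => ⟨by simpa using hfv a 0 (X.one_le_mult a), fun l hl hl' => ?_⟩⟩
  have := hfv a l hl'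
  simpa [Nat.one_le_iff_ne_zero.1 hl, Nat.factorial_ne_zero] using this

/-- `f` is a peak function of `X` at `a`: it is `1` at `a` and vanishes on the rest of the
variety, with multiplicities. -/
def Variety.IsPeak (X : Variety) (a : X.points) (f : ℂ → ℂ) : Prop :=
  f a = 1 ∧ ∀ b : X.points, b ≠ a → ∀ l < X.mult b, iteratedDeriv l f b = 0

theorem Variety.isPeak_of_values {X : Variety} {a : X.points} {f : ℂ → ℂ} (ha : f a = 1)
    (h0 : ∀ b : X.points, b ≠ a → f b = 0)
    (h1 : ∀ b : X.points, ∀ l, 1 ≤ l → l < X.mult b → iteratedDeriv l f b = 0) :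
    X.IsPeak a f := by
  refine ⟨ha, fun b hb l hl => ?_⟩
  rcases Nat.eq_zero_or_pos l with rfl | hl0
  · simpa using h0 b hb
  · exact h1 b l hl0 hl

theorem Variety.IsInterpolating.exists_isPeak {X : Variety} {p : ℂ → ℝ}
    (hX : X.IsInterpolating p) (hp0 : ∀ z, 0 ≤ p z) (a : X.points) :
    ∃ f ∈ weightedAlgebra p, X.IsPeak a f := by
  classical
  obtain ⟨f, hf, h⟩ := hX.exists_of_norm_le_one hp0 (Pi.single a 1) fun b => by
    by_cases hb : b = a
    · subst hb; simp
    · simp [hb]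
  exact ⟨f, hf, Variety.isPeak_of_values (by simp [(h a).1])
    (fun b hb => by simp [(h b).1, hb]) fun b => (h b).2⟩

/-- The interpolation property is uniform: peak functions can be chosen with a common growth
bound. -/
theorem Variety.IsInterpolating.exists_uniform_isPeak {X : Variety} {p : ℂ → ℝ}
    (hX : X.IsInterpolating p) (hp : Continuous p) (hp0 : ∀ z, 0 ≤ p z) :
    ∃ C : ℝ, 0 < C ∧ ∀ a : X.points, ∃ f : ℂ → ℂ, Differentiable ℂ f ∧
      (∀ z, ‖f z‖ ≤ Real.exp (C + C * p z)) ∧ X.IsPeak a f := by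
  classical
  -- Only positive orders are constrained; the values of order zero are the data that vary.
  set T : Set (ℂ × ℕ) := {t | ∃ b : X.points, t.1 = b ∧ 1 ≤ t.2 ∧ t.2 < X.mult b} with hT
  set S : ℕ → Set (ℂ → ℂ) := fun n => {f : ℂ → ℂ | Differentiable ℂ f ∧
    (∀ z, ‖f z‖ ≤ Real.exp (n + n * p z)) ∧ ∀ t ∈ T, iteratedDeriv t.2 f t.1 = 0} with hS
  have hScomp : ∀ n, IsCompact (S n) := fun n =>
    isCompact_setOf_differentiable_norm_le_iteratedDeriv_eq_zero (by fun_prop) T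
  let ρ : (ℂ → ℂ) → X.points → ℂ := fun f a => f a
  have hρ : Continuous ρ := continuous_pi fun a => continuous_apply (a : ℂ)
  -- The data space is compact Hausdorff, hence Baire. It is covered by the closed sets of data
  -- attained with growth constant `n`, so one of these has interior.
  let D : Type := X.points → closedBall (0 : ℂ) 1
  let j : D → X.points → ℂ := fun v a => v a
  have hj : Continuous j := continuous_pi fun a => continuous_subtype_val.comp (continuous_apply a)
  have hcl : ∀ n, IsClosed (j ⁻¹' (ρ '' S n)) := fun n =>
    (((hScomp n).image hρ).isClosed).preimage hj
  have hex : ∀ n : ℕ, ∀ A B : ℝ, A ≤ n → B ≤ n → ∀ z,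
      Real.exp (A + B * p z) ≤ Real.exp (n + n * p z) := fun n A B hA hB z =>
    Real.exp_le_exp.2 (add_le_add hA (mul_le_mul_of_nonneg_right hB (hp0 z)))
  have hun : ⋃ n, j ⁻¹' (ρ '' S n) = univ := by
    refine eq_univ_of_forall fun v => ?_
    obtain ⟨f, ⟨hfd, A, B, -, -, hAB⟩, hf⟩ := hX.exists_of_norm_le_one hp0 (j v) fun a => by
      exact mem_closedBall_zero_iff.1 (v a).2
    obtain ⟨n, hn⟩ := exists_nat_ge (max A B)
    refine mem_iUnion.2 ⟨n, f, ⟨hfd, fun z => (hAB z).trans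
      (hex n A B ((le_max_left _ _).trans hn) ((le_max_right _ _).trans hn) z), ?_⟩,
      funext fun a => (hf a).1⟩
    rintro ⟨_, l⟩ ⟨b, rfl, h1, h2⟩
    exact (hf b).2 l h1 h2
  have : Nonempty D := ⟨fun _ => ⟨0, by simp⟩⟩
  have : CompactSpace D := inferInstanceAs (CompactSpace (X.points → closedBall (0 : ℂ) 1))
  have : T2Space D := inferInstanceAs (T2Space (X.points → closedBall (0 : ℂ) 1))
  obtain ⟨n, v₀, hv₀⟩ := nonempty_interior_of_iUnion_of_closed hcl hun
  obtain ⟨I, u, hu, hsub⟩ := isOpen_pi_iff.1 isOpen_interior v₀ hv₀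
  -- A basic open set restricts only the finitely many coordinates in `I`; every other coordinate
  -- may be changed at will.
  have hmem : ∀ a ∉ I, ∀ c : closedBall (0 : ℂ) 1,
      ∃ f ∈ S n, ρ f = j (Function.update v₀ a c) := fun a ha c => by
    have : Function.update v₀ a c ∈ interior (j ⁻¹' (ρ '' S n)) := hsub fun b hb => by
      have hba : b ≠ a := fun h => ha (h ▸ hb)
      rw [Function.update_of_ne hba]
      exact (hu b hb).2
    obtain ⟨f, hf, e⟩ := interior_subset this
    exact ⟨f, hf, e⟩
  choose g hg hgp using hX.exists_isPeak hp0
  choose hgd A B hA hB hAB using hg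
  set K : ℝ := ∑ a ∈ I, (A a + B a) with hK
  have hKle : ∀ a ∈ I, A a + B a ≤ K := fun a ha =>
    Finset.single_le_sum (f := fun a => A a + B a)
      (fun b _ => (add_pos (hA b) (hB b)).le) ha
  have hK0 : 0 ≤ K := Finset.sum_nonneg fun b _ => (add_pos (hA b) (hB b)).le
  -- `K` covers the individual peak functions at the points of `I`; the `1` pays for the factor `2 ≤
  -- e` in a difference of two functions.
  refine ⟨n + 1 + K, by positivity, fun a => ?_⟩
  by_cases ha : a ∈ I
  · refine ⟨g a, hgd a, fun z => (hAB a z).trans (Real.exp_le_exp.2 ?_), hgp a⟩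
    have h1 : A a ≤ n + 1 + K := by linarith [hKle a ha, hB a, (Nat.cast_nonneg n : (0:ℝ) ≤ n)]
    have h2 : B a ≤ n + 1 + K := by linarith [hKle a ha, hA a, (Nat.cast_nonneg n : (0:ℝ) ≤ n)]
    exact add_le_add h1 (mul_le_mul_of_nonneg_right h2 (hp0 z))
  -- The two data differ only at `a`, by `1`, so the difference of their interpolants is a peak
  -- function.
  · obtain ⟨f₁, hf₁, e₁⟩ := hmem a ha ⟨1, by simp⟩
    obtain ⟨f₀, hf₀, e₀⟩ := hmem a ha ⟨0, by simp⟩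
    refine ⟨fun z => f₁ z - f₀ z, hf₁.1.sub hf₀.1, fun z => ?_,
      Variety.isPeak_of_values ?_ (fun b hb => ?_) fun b l h1 h2 => ?_⟩
    · calc ‖f₁ z - f₀ z‖ ≤ ‖f₁ z‖ + ‖f₀ z‖ := norm_sub_le _ _
        _ ≤ 2 * Real.exp (n + n * p z) := by linarith [hf₁.2.1 z, hf₀.2.1 z]
        _ ≤ Real.exp 1 * Real.exp (n + n * p z) := by
          gcongr
          linarith [Real.add_one_le_exp 1]
        _ = Real.exp (1 + (n + n * p z)) := (Real.exp_add _ _).symm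
        _ ≤ _ := Real.exp_le_exp.2 (by nlinarith [hp0 z, mul_nonneg hK0 (hp0 z)])
    · have h1 := congrFun e₁ a
      have h0 := congrFun e₀ a
      simp only [ρ, j, Function.update_self] at h1 h0
      simp [h1, h0]
    · have h1 := congrFun e₁ b
      have h0 := congrFun e₀ b
      simp only [ρ, j, Function.update_of_ne hb] at h1 h0
      simp [h1, h0]
    · have ht : ((b : ℂ), l) ∈ T := ⟨b, rfl, h1, h2⟩
      have e := iteratedDeriv_fun_sub (n := l) (x := (b : ℂ)) hf₁.1.contDiff.contDiffAt
        hf₀.1.contDiff.contDiffAt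
      rw [e, hf₁.2.2 _ ht, hf₀.2.2 _ ht, sub_zero]

/-- The points of an interpolating variety do not accumulate outside of the variety. -/
theorem Variety.IsInterpolating.eventually_notMem {X : Variety} {p : ℂ → ℝ}
    (hX : X.IsInterpolating p) (hp0 : ∀ z, 0 ≤ p z) {x : ℂ} (hx : x ∉ X.points) :
    ∀ᶠ z in 𝓝 x, z ∉ X.points := by
  by_contra h
  rw [not_eventually] at h
  simp only [not_not] at h
  obtain ⟨a, ha⟩ := h.exists
  obtain ⟨f, hf, hpk⟩ := hX.exists_isPeak hp0 ⟨a, ha⟩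
  have hne : ∀ᶠ z in 𝓝 x, z ≠ a := isOpen_ne.mem_nhds fun h => hx (h ▸ ha)
  -- A peak function at one point near `x` vanishes at the others, which accumulate at `x`; the
  -- identity theorem then makes it zero.
  have hfr : ∃ᶠ z in 𝓝[≠] x, f z = 0 := by
    rw [frequently_nhdsWithin_iff]
    refine (h.and_eventually hne).mono fun z hz => ⟨?_, fun hzx => hx (hzx ▸ hz.1)⟩
    have := hpk.2 ⟨z, hz.1⟩ (fun h => hz.2 (congrArg Subtype.val h)) 0
      (X.one_le_mult _)
    simpa using this
  have := AnalyticOnNhd.eqOn_zero_of_preconnected_of_frequently_eq_zero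
    (fun z _ => hf.1.analyticAt z) isPreconnected_univ (mem_univ x) hfr (mem_univ a)
  exact one_ne_zero (hpk.1.symm.trans this)


/-! ### Jensen's formula and the Green function -/

/-- Jensen's inequality for part of the zeros. -/
theorem sum_mul_log_le_circleAverage {ι : Type*} {g : ℂ → ℂ} {r : ℝ} (hr : 0 < r)
    (hg : AnalyticOnNhd ℂ g (closedBall 0 r)) (hg0 : g 0 = 1) (s : Finset ι) (w : ι → ℂ)
    (hw : Set.InjOn w s) (m : ι → ℕ) (hwr : ∀ i ∈ s, w i ∈ closedBall (0 : ℂ) r)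
    (hm : ∀ i ∈ s, (m i : ℕ∞) ≤ analyticOrderAt g (w i)) :
    ∑ i ∈ s, (m i : ℝ) * Real.log (r * ‖w i‖⁻¹) ≤
      Real.circleAverage (fun z => Real.log ‖g z‖) 0 r := by
  classical
  have hr' : |r| = r := abs_of_pos hr
  have hg' : AnalyticOnNhd ℂ g (closedBall 0 |r|) := by rwa [hr']
  rw [AnalyticOnNhd.circleAverage_log_norm hr.ne' hg' (by simp [hg0]), hg0, norm_one, Real.log_one,
    add_zero]
  set d := MeromorphicOn.divisor g (closedBall 0 |r|) with hd
  have hlog : ∀ u ∈ closedBall (0 : ℂ) r, 0 ≤ Real.log (r * ‖u‖⁻¹) := by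
    intro u hu
    rw [mem_closedBall_zero_iff] at hu
    -- At `u = 0` the term is `0` by the conventions `0⁻¹ = 0` and `log 0 = 0`.
    rcases eq_or_ne u 0 with rfl | hu0
    · simp
    · have : 0 < ‖u‖ := norm_pos_iff.2 hu0
      refine Real.log_nonneg ?_
      rw [← div_eq_mul_inv, one_le_div this]
      exact hu
  have hdu : ∀ u ∈ closedBall (0 : ℂ) r, d u = (analyticOrderAt g u).toNat := by
    intro u hu
    rw [hd, MeromorphicOn.AnalyticOnNhd.divisor_apply hg' (by rwa [hr'])]
    cases analyticOrderAt g u <;> simp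
  have hd0 : ∀ u, u ∉ closedBall (0 : ℂ) r → d u = 0 := by
    intro u hu
    exact Function.locallyFinsuppWithin.apply_eq_zero_of_notMem d (by rwa [hr'])
  have hfin := d.finiteSupport (isCompact_closedBall 0 |r|)
  have hnn : ∀ u, 0 ≤ (d u : ℝ) * Real.log (r * ‖0 - u‖⁻¹) := by
    intro u
    by_cases hu : u ∈ closedBall (0 : ℂ) r
    · rw [hdu u hu, zero_sub, norm_neg]
      exact mul_nonneg (by positivity) (hlog u hu)
    · simp [hd0 u hu]
  rw [finsum_eq_sum_of_support_subset (s := hfin.toFinset ∪ s.image w)]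
  · calc ∑ i ∈ s, (m i : ℝ) * Real.log (r * ‖w i‖⁻¹)
        ≤ ∑ i ∈ s, (d (w i) : ℝ) * Real.log (r * ‖0 - w i‖⁻¹) := by
          refine Finset.sum_le_sum fun i hi => ?_
          rw [zero_sub, norm_neg]
          refine mul_le_mul_of_nonneg_right ?_ (hlog _ (hwr i hi))
          rw [hdu _ (hwr i hi)]
          -- `toNat` sends `⊤` to `0`, so infinite order must be excluded; `g 0 = 1` does this.
          have htop : analyticOrderAt g (w i) ≠ ⊤ :=
            hg.analyticOrderAt_ne_top_of_isPreconnected (convex_closedBall 0 r).isPreconnected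
              (mem_closedBall_self hr.le) (hwr i hi)
              (by rw [(hg 0 (mem_closedBall_self hr.le)).analyticOrderAt_eq_zero.2 (by simp [hg0])]
                  simp)
          have := ENat.toNat_le_toNat (hm i hi) htop
          simp only [ENat.toNat_natCast] at this
          exact_mod_cast this
      _ = ∑ u ∈ s.image w, (d u : ℝ) * Real.log (r * ‖0 - u‖⁻¹) := by
          rw [Finset.sum_image hw]
      _ ≤ _ := Finset.sum_le_sum_of_subset_of_nonneg Finset.subset_union_right fun u _ _ => hnn u
  · intro u hu
    simp only [Finset.coe_union, Set.mem_union]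
    left
    simp only [Finite.coe_toFinset, Function.mem_support]
    intro h
    simp [h] at hu

/-- The conformal map of the unit disc onto the upper half-plane that maps `0` to `a`. -/
noncomputable def discToHalfPlane (a w : ℂ) : ℂ := (a - starRingEnd ℂ a * w) / (1 - w)

theorem analyticAt_discToHalfPlane (a : ℂ) {w : ℂ} (hw : w ≠ 1) :
    AnalyticAt ℂ (discToHalfPlane a) w := by
  have : 1 - w ≠ 0 := sub_ne_zero.2 hw.symm
  unfold discToHalfPlane
  fun_prop (disch := assumption)

theorem deriv_discToHalfPlane_ne_zero {a : ℂ} (ha : 0 < a.im) {w : ℂ} (hw : w ≠ 1) :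
    deriv (discToHalfPlane a) w ≠ 0 := by
  have h1 : 1 - w ≠ 0 := sub_ne_zero.2 hw.symm
  have hd : HasDerivAt (discToHalfPlane a)
      (((-starRingEnd ℂ a) * (1 - w) - (a - starRingEnd ℂ a * w) * (-1)) / (1 - w) ^ 2) w := by
    refine HasDerivAt.fun_div ?_ ?_ h1
    · simpa using ((hasDerivAt_id w).const_mul (starRingEnd ℂ a)).const_sub a
    · simpa using (hasDerivAt_id w).const_sub 1
  rw [hd.deriv]
  refine div_ne_zero ?_ (pow_ne_zero 2 h1)
  have : -starRingEnd ℂ a * (1 - w) - (a - starRingEnd ℂ a * w) * (-1) = a - starRingEnd ℂ a := by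
    ring
  rw [this, Complex.sub_conj]
  simp [ha.ne']

theorem sub_conj_ne_zero_of_im_pos {a b : ℂ} (ha : 0 < a.im) (hb : 0 < b.im) :
    b - starRingEnd ℂ a ≠ 0 := fun h => by
  have := congrArg Complex.im h
  simp at this
  linarith

theorem div_sub_conj_ne_one {a b : ℂ} (ha : 0 < a.im) (hb : 0 < b.im) :
    (b - a) / (b - starRingEnd ℂ a) ≠ 1 := fun h => by
  rw [div_eq_one_iff_eq (sub_conj_ne_zero_of_im_pos ha hb)] at h
  have := congrArg Complex.im h
  simp at this
  linarith

theorem discToHalfPlane_div_sub_conj {a b : ℂ} (ha : 0 < a.im) (hb : 0 < b.im) :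
    discToHalfPlane a ((b - a) / (b - starRingEnd ℂ a)) = b := by
  have h1 := sub_conj_ne_zero_of_im_pos ha hb
  have h2 := sub_ne_zero.2 (div_sub_conj_ne_one ha hb).symm
  rw [discToHalfPlane, div_eq_iff h2]
  field_simp
  ring

theorem norm_div_sub_conj (a b : ℂ) :
    ‖(b - a) / (b - starRingEnd ℂ a)‖ = ‖(a - b) / (a - starRingEnd ℂ b)‖ := by
  rw [norm_div, norm_div, norm_sub_rev b a, ← Complex.norm_conj (b - starRingEnd ℂ a), map_sub,
    Complex.conj_conj, norm_sub_rev _ a]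

theorem norm_div_sub_conj_lt_one {a b : ℂ} (ha : 0 < a.im) (hb : 0 < b.im) :
    ‖(b - a) / (b - starRingEnd ℂ a)‖ < 1 := by
  have h1 := norm_pos_iff.2 (sub_conj_ne_zero_of_im_pos ha hb)
  rw [norm_div, div_lt_one h1]
  refine lt_of_pow_lt_pow_left₀ 2 (norm_nonneg _) ?_
  rw [Complex.sq_norm, Complex.sq_norm, Complex.normSq_apply, Complex.normSq_apply]
  simp
  nlinarith [mul_pos ha hb]

theorem greenUpperHalfPlane_nonneg {a b : ℂ} (ha : 0 < a.im) (hb : 0 < b.im) :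
    0 ≤ greenUpperHalfPlane a b := by
  rw [greenUpperHalfPlane, ← norm_div_sub_conj, Real.log_inv]
  exact neg_nonneg.2 (Real.log_nonpos (norm_nonneg _) (norm_div_sub_conj_lt_one ha hb).le)

/-- If `f a = 1` and the means of `log |f|` over the images of the circles `|w| = r` stay bounded
by `K`, then the sums of the Green function with pole `a` over the zeros of `f` in the upper
half-plane do so too. -/
theorem sum_mul_greenUpperHalfPlane_le {ι : Type*} {f : ℂ → ℂ} (hf : Differentiable ℂ f) {a : ℂ}
    (ha : 0 < a.im) (hfa : f a = 1) (s : Finset ι) (b : ι → ℂ) (hb : Set.InjOn b s)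
    (hbim : ∀ i ∈ s, 0 < (b i).im) (m : ι → ℕ)
    (hm : ∀ i ∈ s, (m i : ℕ∞) ≤ analyticOrderAt f (b i)) (hba : ∀ i ∈ s, b i ≠ a) {K : ℝ}
    (hK : ∀ r, 0 < r → r < 1 →
      Real.circleAverage (fun w => Real.log ‖f (discToHalfPlane a w)‖) 0 r ≤ K) :
    ∑ i ∈ s, (m i : ℝ) * greenUpperHalfPlane a (b i) ≤ K := by
  set w : ι → ℂ := fun i => (b i - a) / (b i - starRingEnd ℂ a) with hw
  -- Jensen is applied for `r < 1` only, since `discToHalfPlane a` has a pole at `1`; the finite sum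
  -- is continuous at `r = 1`.
  have hlim : Tendsto (fun r : ℝ => ∑ i ∈ s, (m i : ℝ) * Real.log (r * ‖w i‖⁻¹)) (𝓝[<] 1)
      (𝓝 (∑ i ∈ s, (m i : ℝ) * Real.log (1 * ‖w i‖⁻¹))) := by
    refine tendsto_finsetSum _ fun i hi => Tendsto.const_mul _ ?_
    have hw0 : w i ≠ 0 := div_ne_zero (sub_ne_zero.2 (hba i hi))
      (sub_conj_ne_zero_of_im_pos ha (hbim i hi))
    have : ContinuousAt (fun r : ℝ => Real.log (r * ‖w i‖⁻¹)) 1 := by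
      refine ContinuousAt.log (by fun_prop) ?_
      simpa using hw0
    exact this.tendsto.mono_left nhdsWithin_le_nhds
  have hsum : ∑ i ∈ s, (m i : ℝ) * greenUpperHalfPlane a (b i) =
      ∑ i ∈ s, (m i : ℝ) * Real.log (1 * ‖w i‖⁻¹) := by
    refine Finset.sum_congr rfl fun i _ => ?_
    rw [greenUpperHalfPlane, one_mul, hw, norm_div_sub_conj]
  rw [hsum]
  refine le_of_tendsto hlim ?_
  have hev : ∀ᶠ r : ℝ in 𝓝[<] 1, ∀ i ∈ s, ‖w i‖ < r := by
    rw [Filter.eventually_all_finset]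
    intro i hi
    exact nhdsWithin_le_nhds (lt_mem_nhds (norm_div_sub_conj_lt_one ha (hbim i hi)))
  have h0 : ∀ᶠ r : ℝ in 𝓝[<] 1, 0 < r := nhdsWithin_le_nhds (lt_mem_nhds one_pos)
  filter_upwards [hev, h0, self_mem_nhdsWithin] with r hr hr0 hr1
  rw [mem_Iio] at hr1
  refine le_trans ?_ (hK r hr0 hr1)
  have hne : ∀ z ∈ closedBall (0 : ℂ) r, z ≠ 1 := by
    rintro z hz rfl
    rw [mem_closedBall_zero_iff, norm_one] at hz
    linarith
  refine sum_mul_log_le_circleAverage (g := f ∘ discToHalfPlane a) hr0 (fun z hz => ?_) ?_ s w ?_ m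
    (fun i hi => ?_) fun i hi => ?_
  · exact (hf.analyticAt _).comp (analyticAt_discToHalfPlane a (hne z hz))
  · simp [discToHalfPlane, hfa]
  · intro i hi k hk hik
    refine hb hi hk ?_
    rw [← discToHalfPlane_div_sub_conj ha (hbim i hi), ← discToHalfPlane_div_sub_conj ha (hbim k hk)]
    exact congrArg _ hik
  · rw [mem_closedBall_zero_iff]
    exact (hr i hi).le
  · have h1 : w i ≠ 1 := div_sub_conj_ne_one ha (hbim i hi)
    rw [analyticOrderAt_comp_of_deriv_ne_zero (analyticAt_discToHalfPlane a h1)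
      (deriv_discToHalfPlane_ne_zero ha h1), discToHalfPlane_div_sub_conj ha (hbim i hi)]
    exact hm i hi


/-! ### Beurling functions -/

namespace IsBeurlingFunction

open MeasureTheory

variable {ω : ℝ → ℝ}

theorem map_natCast_mul_le (hω : IsBeurlingFunction ω) (n : ℕ) {t : ℝ} (ht : 0 ≤ t) :
    ω (n * t) ≤ n * ω t := by
  induction n with
  | zero => simp [hω.map_zero]
  | succ n ih =>
    have := hω.subadditive (n * t) t (by positivity) ht
    push_cast
    rw [add_mul, one_mul, add_mul, one_mul]
    linarith

theorem map_mul_le (hω : IsBeurlingFunction ω) {k t : ℝ} (hk : 0 ≤ k) (ht : 0 ≤ t) :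
    ω (k * t) ≤ (k + 1) * ω t :=
  calc ω (k * t) ≤ ω (⌈k⌉₊ * t) :=
        hω.monotoneOn (mem_Ici.2 (by positivity)) (mem_Ici.2 (by positivity))
          (mul_le_mul_of_nonneg_right (Nat.le_ceil k) ht)
    _ ≤ ⌈k⌉₊ * ω t := hω.map_natCast_mul_le _ ht
    _ ≤ (k + 1) * ω t :=
        mul_le_mul_of_nonneg_right (Nat.ceil_lt_add_one hk).le (hω.nonneg t ht)

/-- The logarithmic lower bound gives `ω 2 > 0`, and `ω 2 ≤ (2 / t + 1) ω t`. -/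
theorem pos (hω : IsBeurlingFunction ω) {t : ℝ} (ht : 0 < t) : 0 < ω t := by
  obtain ⟨c, hc, hlog⟩ := hω.log_le
  have h1 : 1 < (2 / t) * t := by rw [div_mul_cancel₀ _ ht.ne']; norm_num
  have h2 : 0 < Real.log (1 + 2 / t * t) := Real.log_pos (by linarith)
  have h3 : 0 < ω (2 / t * t) := pos_of_mul_pos_right (h2.trans_le (hlog _ h1)) hc.le
  have h4 := hω.map_mul_le (k := 2 / t) (by positivity) ht.le
  exact pos_of_mul_pos_right (h3.trans_le h4) (by positivity)

theorem continuous_beurlingWeight (hω : IsBeurlingFunction ω) : Continuous (beurlingWeight ω) := by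
  have : Continuous fun z : ℂ => ω ‖z‖ :=
    hω.continuousOn.comp_continuous continuous_norm fun z => norm_nonneg z
  exact Complex.continuous_im.abs.add this

theorem beurlingWeight_nonneg (hω : IsBeurlingFunction ω) (z : ℂ) : 0 ≤ beurlingWeight ω z :=
  add_nonneg (abs_nonneg _) (hω.nonneg _ (norm_nonneg _))

/-- The substitution `t ↦ 1/t` preserves `dt / (1 + t²)`, and `1 + t² ≤ 1 + b²` on `(0, b]`. -/
theorem intervalIntegrable_inv (hω : IsBeurlingFunction ω) {b : ℝ} (hb : 0 ≤ b) :
    IntervalIntegrable (fun θ => ω θ⁻¹) volume 0 b := by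
  have h1 : IntegrableOn (fun t => ω t⁻¹ / (1 + t ^ 2)) (Ioi 0) := by
    rw [← integrableOn_Ioi_comp_rpow_iff' _ (by norm_num : (-1 : ℝ) ≠ 0)]
    refine hω.integrable.congr_fun (fun x hx => ?_) measurableSet_Ioi
    have hx0 : (0 : ℝ) < x := hx
    have e2 : x ^ (-1 - 1 : ℝ) = (x ^ 2)⁻¹ := by
      rw [show (-1 - 1 : ℝ) = -(2 : ℕ) by norm_num, Real.rpow_neg hx0.le, Real.rpow_natCast]
    simp only [Real.rpow_neg_one, inv_inv, smul_eq_mul, e2]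
    field_simp
    ring
  rw [intervalIntegrable_iff_integrableOn_Ioc_of_le hb]
  have h2 : IntegrableOn (fun t => (1 + b ^ 2) * (ω t⁻¹ / (1 + t ^ 2))) (Ioc 0 b) :=
    (h1.mono_set Ioc_subset_Ioi_self).const_mul _
  refine Integrable.mono' h2 ?_ ?_
  · refine ContinuousOn.aestronglyMeasurable ?_ measurableSet_Ioc
    refine hω.continuousOn.comp (continuousOn_inv₀.mono fun t ht => (ne_of_gt ht.1)) fun t ht => ?_
    exact inv_nonneg.2 ht.1.le
  · refine (ae_restrict_iff' measurableSet_Ioc).2 (Eventually.of_forall fun t ht => ?_)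
    have h0 : 0 ≤ ω t⁻¹ := hω.nonneg _ (inv_nonneg.2 ht.1.le)
    rw [Real.norm_of_nonneg h0, mul_div_assoc', le_div_iff₀ (by positivity), mul_comm]
    have : t ^ 2 ≤ b ^ 2 := pow_le_pow_left₀ ht.1.le ht.2 2
    exact mul_le_mul_of_nonneg_right (by linarith) h0

end IsBeurlingFunction

/-! ### Means of the weight over images of circles -/

/-- On the unit circle the distance to `1` is `2 |sin (θ / 2)|`. Moving to radius `r` costs at most
`1 - r`, itself at most the new distance. -/
theorem sin_half_le_norm_one_sub_circleMap {r θ : ℝ} (hr0 : 0 ≤ r) (hr1 : r ≤ 1) :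
    Real.sin (θ / 2) ≤ ‖1 - circleMap 0 r θ‖ := by
  have h1 : ‖(1 : ℂ) - circleMap 0 1 θ‖ = 2 * |Real.sin (θ / 2)| := by
    rw [norm_sub_rev, circleMap_zero]
    have := Complex.norm_exp_I_mul_ofReal_sub_one θ
    rw [mul_comm] at this
    simpa using this
  have h2 : ‖(1 : ℂ) - circleMap 0 1 θ‖ ≤ ‖1 - circleMap 0 r θ‖ + (1 - r) := by
    have e : (1 : ℂ) - circleMap 0 1 θ = (1 - circleMap 0 r θ) + ((r - 1 : ℝ) : ℂ) * circleMap 0 1 θ := by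
      simp [circleMap_zero]
      ring
    rw [e]
    refine (norm_add_le _ _).trans (add_le_add_right ?_ _)
    rw [norm_mul, Complex.norm_real, norm_circleMap_zero, abs_one, mul_one, Real.norm_eq_abs,
      abs_sub_comm, abs_of_nonneg (by linarith)]
  have h3 : 1 - r ≤ ‖1 - circleMap 0 r θ‖ := by
    have := norm_sub_norm_le (1 : ℂ) (circleMap 0 r θ)
    rwa [norm_one, norm_circleMap_zero, abs_of_nonneg hr0] at this
  linarith [le_abs_self (Real.sin (θ / 2))]

theorem div_pi_le_sin_half {θ : ℝ} (h0 : 0 ≤ θ) (h1 : θ ≤ Real.pi) :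
    θ / Real.pi ≤ Real.sin (θ / 2) := by
  have := Real.mul_le_sin (x := θ / 2) (by linarith) (by linarith)
  calc θ / Real.pi = 2 / Real.pi * (θ / 2) := by ring
    _ ≤ _ := this

/-- The map is `a + 2i (Im a) w / (1 - w)`. The parameter `t` will be `θ` or `2π - θ`, the angular
distance to the pole `w = 1`. -/
theorem norm_discToHalfPlane_circleMap_le {a : ℂ} (ha : 0 < a.im) {r θ : ℝ} (hr0 : 0 ≤ r)
    (hr1 : r < 1) {t : ℝ} (ht : 0 < t) (htθ : t / Real.pi ≤ Real.sin (θ / 2)) :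
    ‖discToHalfPlane a (circleMap 0 r θ)‖ ≤ ‖a‖ + 2 * Real.pi * a.im * t⁻¹ := by
  set w := circleMap 0 r θ with hw
  have hwn : ‖w‖ = r := by rw [hw, norm_circleMap_zero, abs_of_nonneg hr0]
  have hpi := Real.pi_pos
  have hlow : t / Real.pi ≤ ‖1 - w‖ := htθ.trans (sin_half_le_norm_one_sub_circleMap hr0 hr1.le)
  have h1 : 0 < ‖1 - w‖ := (by positivity : 0 < t / Real.pi).trans_le hlow
  have h1w : 1 - w ≠ 0 := norm_pos_iff.1 h1
  have e : discToHalfPlane a w = a + (a - starRingEnd ℂ a) * w / (1 - w) := by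
    rw [discToHalfPlane]
    field_simp
    ring
  rw [e]
  refine (norm_add_le _ _).trans (add_le_add_right ?_ _)
  rw [Complex.sub_conj, norm_div, norm_mul, hwn, norm_mul, Complex.norm_I, Complex.norm_real,
    Real.norm_of_nonneg (by linarith), mul_one, div_le_iff₀ h1]
  have h2 : 1 ≤ Real.pi * t⁻¹ * ‖1 - w‖ := by
    rw [div_le_iff₀ hpi] at hlow
    rw [← div_eq_mul_inv, div_mul_eq_mul_div, one_le_div ht]
    linarith
  calc 2 * a.im * r ≤ 2 * a.im * (Real.pi * t⁻¹ * ‖1 - w‖) :=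
        mul_le_mul_of_nonneg_left (hr1.le.trans h2) (by linarith)
    _ = _ := by ring

theorem im_discToHalfPlane (a w : ℂ) :
    (discToHalfPlane a w).im = a.im * (1 - Complex.normSq w) / Complex.normSq (1 - w) := by
  rw [discToHalfPlane, Complex.div_im, Complex.normSq_apply w]
  simp
  ring

theorem ne_one_of_mem_closedBall {r : ℝ} (hr1 : r < 1) {z : ℂ} (hz : z ∈ closedBall (0 : ℂ) r) :
    z ≠ 1 := by
  rintro rfl
  rw [mem_closedBall_zero_iff, norm_one] at hz
  linarith

theorem continuousOn_discToHalfPlane (a : ℂ) {r : ℝ} (hr0 : 0 < r) (hr1 : r < 1) :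
    ContinuousOn (discToHalfPlane a) (sphere 0 |r|) := fun z hz =>
  (analyticAt_discToHalfPlane a (ne_one_of_mem_closedBall hr1
    (sphere_subset_closedBall (by rwa [abs_of_pos hr0] at hz)))).continuousAt.continuousWithinAt

/-- The imaginary part is nonnegative on these circles, so the absolute value drops and the mean
value property applies. -/
theorem circleAverage_abs_im_discToHalfPlane {a : ℂ} (ha : 0 < a.im) {r : ℝ} (hr0 : 0 < r)
    (hr1 : r < 1) :
    Real.circleAverage (fun w => |(discToHalfPlane a w).im|) 0 r = a.im := by
  have hr' : |r| = r := abs_of_pos hr0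
  have hd : DiffContOnCl ℂ (discToHalfPlane a) (ball 0 |r|) := by
    rw [hr']
    refine DifferentiableOn.diffContOnCl fun z hz => ?_
    exact (analyticAt_discToHalfPlane a (ne_one_of_mem_closedBall hr1
      (closure_ball_subset_closedBall hz))).differentiableAt.differentiableWithinAt
  have h1 := Complex.imCLM.circleAverage_comp_comm (c := 0) (R := r) (f := discToHalfPlane a)
    (ContinuousOn.circleIntegrable' (continuousOn_discToHalfPlane a hr0 hr1))
  rw [hd.circleAverage] at h1
  have h2 : discToHalfPlane a 0 = a := by simp [discToHalfPlane]
  rw [h2] at h1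
  rw [← Complex.imCLM_apply, ← h1]
  refine Real.circleAverage_congr_sphere fun z hz => ?_
  simp only [Function.comp_apply, Complex.imCLM_apply]
  refine abs_of_nonneg ?_
  rw [im_discToHalfPlane]
  have hz' : ‖z‖ = r := by rw [hr'] at hz; simpa using hz
  have : Complex.normSq z ≤ 1 := by
    rw [Complex.normSq_eq_norm_sq, hz']
    exact pow_le_one₀ hr0.le hr1.le
  exact div_nonneg (mul_nonneg ha.le (by linarith)) (Complex.normSq_nonneg _)

/-- The means of the weight over the images in the upper half-plane of the circles `|w| = r` are
bounded in terms of the weight at the image of the centre. -/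
theorem IsBeurlingFunction.exists_circleAverage_le {ω : ℝ → ℝ} (hω : IsBeurlingFunction ω) :
    ∃ K : ℝ, 0 ≤ K ∧ ∀ a : ℂ, 0 < a.im → ∀ r, 0 < r → r < 1 →
      Real.circleAverage (fun w => beurlingWeight ω (discToHalfPlane a w)) 0 r ≤
        K * (1 + beurlingWeight ω a) := by
  have hpi := Real.pi_pos
  -- One summand for each end of `[0, 2π]`, where the circle comes closest to the pole.
  set h : ℝ → ℝ := fun θ => ω θ⁻¹ + ω (2 * Real.pi - θ)⁻¹ with hh
  have hi1 := hω.intervalIntegrable_inv (b := 2 * Real.pi) (by positivity)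
  have hi : IntervalIntegrable h MeasureTheory.volume 0 (2 * Real.pi) := by
    refine hi1.add ?_
    have := (hi1.comp_sub_left (2 * Real.pi)).symm
    simpa using this
  set J : ℝ := ∫ θ in (0)..(2 * Real.pi), h θ with hJ
  have hJ0 : 0 ≤ J := by
    refine intervalIntegral.integral_nonneg (by positivity) fun θ hθ => ?_
    exact add_nonneg (hω.nonneg _ (inv_nonneg.2 hθ.1))
      (hω.nonneg _ (inv_nonneg.2 (by linarith [hθ.2])))
  refine ⟨1 + J * (2 * Real.pi)⁻¹ * (2 * Real.pi + 1), by positivity, fun a ha r hr0 hr1 => ?_⟩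
  have hφc := continuousOn_discToHalfPlane a hr0 hr1
  have hc1 : ContinuousOn (fun w => |(discToHalfPlane a w).im|) (sphere 0 |r|) :=
    (Complex.continuous_im.comp_continuousOn hφc).abs
  have hc2 : ContinuousOn (fun w => ω ‖discToHalfPlane a w‖) (sphere 0 |r|) :=
    hω.continuousOn.comp hφc.norm fun z _ => norm_nonneg _
  have hadd := Real.circleAverage_fun_add (ContinuousOn.circleIntegrable' hc1)
    (ContinuousOn.circleIntegrable' hc2)
  have hint2 : IntervalIntegrable (fun θ => ω ‖discToHalfPlane a (circleMap 0 r θ)‖)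
      MeasureTheory.volume 0 (2 * Real.pi) := ContinuousOn.circleIntegrable' hc2
  have hω2 : Real.circleAverage (fun w => ω ‖discToHalfPlane a w‖) 0 r ≤
      ω ‖a‖ + (2 * Real.pi * a.im + 1) * (J * (2 * Real.pi)⁻¹) := by
    have hle : ∫ θ in (0)..(2 * Real.pi), ω ‖discToHalfPlane a (circleMap 0 r θ)‖ ≤
        ∫ θ in (0)..(2 * Real.pi), (ω ‖a‖ + (2 * Real.pi * a.im + 1) * h θ) := by
      -- Comparison on the open interval only: at the endpoints `0⁻¹ = 0`, and the majorant is not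
      -- justified there.
      refine intervalIntegral.integral_mono_on_of_le_Ioo (by positivity) hint2
        (intervalIntegrable_const.add (hi.const_mul _)) fun θ hθ => ?_
      have key : ∀ t, 0 < t → t / Real.pi ≤ Real.sin (θ / 2) →
          ω ‖discToHalfPlane a (circleMap 0 r θ)‖ ≤
            ω ‖a‖ + (2 * Real.pi * a.im + 1) * ω t⁻¹ := fun t ht htθ => by
        have h0 : 0 ≤ 2 * Real.pi * a.im * t⁻¹ := by positivity
        calc _ ≤ ω (‖a‖ + 2 * Real.pi * a.im * t⁻¹) :=
              hω.monotoneOn (mem_Ici.2 (norm_nonneg _))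
                (mem_Ici.2 (add_nonneg (norm_nonneg _) h0))
                (norm_discToHalfPlane_circleMap_le ha hr0.le hr1 ht htθ)
          _ ≤ ω ‖a‖ + ω (2 * Real.pi * a.im * t⁻¹) := hω.subadditive _ _ (norm_nonneg _) h0
          _ ≤ _ := add_le_add_right (hω.map_mul_le (by positivity) (by positivity)) _
      have hn1 := hω.nonneg _ (inv_nonneg.2 hθ.1.le)
      have hn2 := hω.nonneg _ (inv_nonneg.2 (sub_pos.2 hθ.2).le)
      have hk : 0 ≤ 2 * Real.pi * a.im + 1 := by positivity
      rcases le_total θ Real.pi with hθπ | hθπ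
      · refine (key θ hθ.1 (div_pi_le_sin_half hθ.1.le hθπ)).trans ?_
        exact add_le_add_right (mul_le_mul_of_nonneg_left (by linarith) hk) _
      · have hs : (2 * Real.pi - θ) / Real.pi ≤ Real.sin (θ / 2) := by
          have := div_pi_le_sin_half (θ := 2 * Real.pi - θ) (by linarith [hθ.2]) (by linarith)
          rwa [show (2 * Real.pi - θ) / 2 = Real.pi - θ / 2 by ring, Real.sin_pi_sub] at this
        refine (key _ (sub_pos.2 hθ.2) hs).trans ?_
        exact add_le_add_right (mul_le_mul_of_nonneg_left (by linarith) hk) _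
    rw [intervalIntegral.integral_add intervalIntegrable_const (hi.const_mul _),
      intervalIntegral.integral_const, intervalIntegral.integral_const_mul, sub_zero,
      smul_eq_mul] at hle
    rw [Real.circleAverage_def, smul_eq_mul]
    calc _ ≤ (2 * Real.pi)⁻¹ * (2 * Real.pi * ω ‖a‖ + (2 * Real.pi * a.im + 1) * J) :=
          mul_le_mul_of_nonneg_left hle (by positivity)
      _ = _ := by field_simp
  have htot : Real.circleAverage (fun w => beurlingWeight ω (discToHalfPlane a w)) 0 r ≤
      a.im + (ω ‖a‖ + (2 * Real.pi * a.im + 1) * (J * (2 * Real.pi)⁻¹)) := by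
    simp only [beurlingWeight]
    rw [hadd, circleAverage_abs_im_discToHalfPlane ha hr0 hr1]
    exact add_le_add_right hω2 _
  refine htot.trans ?_
  have hp : beurlingWeight ω a = a.im + ω ‖a‖ := by rw [beurlingWeight, abs_of_pos ha]
  rw [hp]
  have hwa := hω.nonneg _ (norm_nonneg a)
  set L := J * (2 * Real.pi)⁻¹ with hL
  have hL0 : 0 ≤ L := by positivity
  have h3 : (2 * Real.pi * a.im + 1) * L ≤
      ((2 * Real.pi + 1) * (1 + (a.im + ω ‖a‖))) * L := by
    refine mul_le_mul_of_nonneg_right ?_ hL0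
    nlinarith [mul_nonneg hpi.le hwa, mul_pos hpi ha]
  nlinarith


/-! ### Lower bound for the weight, and conclusion -/

/-- The weight is bounded below on an interpolating variety without real points. -/
theorem Variety.IsInterpolating.exists_le_beurlingWeight {ω : ℝ → ℝ} (hω : IsBeurlingFunction ω)
    {X : Variety} (hreal : ∀ a ∈ X.points, a.im ≠ 0)
    (hX : X.IsInterpolating (beurlingWeight ω)) :
    ∃ δ : ℝ, 0 < δ ∧ ∀ a ∈ X.points, δ ≤ beurlingWeight ω a := by
  have h0 : (0 : ℂ) ∉ X.points := fun h => hreal 0 h Complex.zero_im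
  obtain ⟨ε, hε, hball⟩ := Metric.eventually_nhds_iff_ball.1
    (hX.eventually_notMem hω.beurlingWeight_nonneg h0)
  refine ⟨ω ε, hω.pos hε, fun a ha => ?_⟩
  have hn : ε ≤ ‖a‖ := by
    by_contra hlt
    exact hball a (mem_ball_zero_iff.2 (not_le.1 hlt)) ha
  have := hω.monotoneOn (mem_Ici.2 hε.le) (mem_Ici.2 (norm_nonneg a)) hn
  exact this.trans (le_add_of_nonneg_left (abs_nonneg _))

theorem circleAverage_log_norm_comp_discToHalfPlane_le {p : ℂ → ℝ} (hp : Continuous p)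
    (hp0 : ∀ z, 0 ≤ p z) {f : ℂ → ℂ} (hf : Differentiable ℂ f) {C : ℝ} (hC : 0 ≤ C)
    (hfC : ∀ z, ‖f z‖ ≤ Real.exp (C + C * p z)) (a : ℂ) {r : ℝ} (hr0 : 0 < r) (hr1 : r < 1) :
    Real.circleAverage (fun w => Real.log ‖f (discToHalfPlane a w)‖) 0 r ≤
      C + C * Real.circleAverage (fun w => p (discToHalfPlane a w)) 0 r := by
  have hc : CircleIntegrable (fun w => p (discToHalfPlane a w)) 0 r :=
    ContinuousOn.circleIntegrable'
      (hp.comp_continuousOn (continuousOn_discToHalfPlane a hr0 hr1))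
  have hc' : CircleIntegrable (fun w => C * p (discToHalfPlane a w)) 0 r :=
    IntervalIntegrable.const_mul hc C
  have e : Real.circleAverage (fun w => C + C * p (discToHalfPlane a w)) 0 r =
      C + C * Real.circleAverage (fun w => p (discToHalfPlane a w)) 0 r := by
    rw [Real.circleAverage_fun_add (circleIntegrable_const C 0 r) hc', Real.circleAverage_const]
    congr 1
    exact Real.circleAverage_fun_smul (a := C)
  rw [← e]
  refine Real.circleAverage_mono ?_ ((circleIntegrable_const C 0 r).add hc') fun w _ => ?_
  · refine MeromorphicOn.circleIntegrable_log_norm (f := fun w => f (discToHalfPlane a w))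
      fun w hw => ?_
    rw [abs_of_pos hr0] at hw
    exact ((hf.analyticAt _).comp (analyticAt_discToHalfPlane a
      (ne_one_of_mem_closedBall hr1 (sphere_subset_closedBall hw)))).meromorphicAt
  -- At zeros of `f` the convention `log 0 = 0` is harmless, the majorant being nonnegative.
  · rcases eq_or_ne (f (discToHalfPlane a w)) 0 with h | h
    · rw [h, norm_zero, Real.log_zero]
      exact add_nonneg hC (mul_nonneg hC (hp0 _))
    · exact (Real.log_le_iff_le_exp (norm_pos_iff.2 h)).2 (hfC _)

theorem proposition3p3 (ω : ℝ → ℝ) (hω : IsBeurlingFunction ω) (X : Variety)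
    (hreal : ∀ a ∈ X.points, a.im ≠ 0)
    (hX : X.IsInterpolating (beurlingWeight ω)) :
    ∃ C : ℝ, 0 < C ∧ ∀ a : X.points, 0 < (a : ℂ).im →
      Summable (fun b : {b : X.points // 0 < (b : ℂ).im ∧ b ≠ a} =>
        (X.mult b : ℝ) * greenUpperHalfPlane a b) ∧
      ∑' b : {b : X.points // 0 < (b : ℂ).im ∧ b ≠ a},
        (X.mult b : ℝ) * greenUpperHalfPlane a b ≤ C * beurlingWeight ω a := by
  have hp := hω.continuous_beurlingWeight
  have hp0 := hω.beurlingWeight_nonneg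
  obtain ⟨δ, hδ, hδX⟩ := hX.exists_le_beurlingWeight hω hreal
  obtain ⟨C, hC, hpeak⟩ := hX.exists_uniform_isPeak hp hp0
  obtain ⟨K, hK, hmean⟩ := hω.exists_circleAverage_le
  refine ⟨(C + C * K) / δ + C * K, by positivity, fun a ha => ?_⟩
  obtain ⟨f, hf, hfC, hfa, hf0⟩ := hpeak a
  have hnn : 0 ≤ fun b : {b : X.points // 0 < (b : ℂ).im ∧ b ≠ a} =>
      (X.mult b : ℝ) * greenUpperHalfPlane a b := fun b =>
    mul_nonneg (Nat.cast_nonneg _) (greenUpperHalfPlane_nonneg ha b.2.1)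
  have hsum : ∀ s : Finset {b : X.points // 0 < (b : ℂ).im ∧ b ≠ a},
      ∑ b ∈ s, (X.mult b : ℝ) * greenUpperHalfPlane a b ≤
        ((C + C * K) / δ + C * K) * beurlingWeight ω a := fun s => by
    have hfin : ∑ b ∈ s, (X.mult b : ℝ) * greenUpperHalfPlane a b ≤
        C + C * (K * (1 + beurlingWeight ω a)) := by
      refine sum_mul_greenUpperHalfPlane_le hf ha hfa s (fun b => ((b : X.points) : ℂ))
        (Subtype.val_injective.comp Subtype.val_injective).injOn (fun b _ => b.2.1)
        (fun b => X.mult b) (fun b _ => ?_)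
        (fun b _ h => b.2.2 (Subtype.val_injective h)) fun r hr0 hr1 => ?_
      · exact (natCast_le_analyticOrderAt_iff_iteratedDeriv_eq_zero (hf.analyticAt _)).2
          (hf0 b b.2.2)
      · exact (circleAverage_log_norm_comp_discToHalfPlane_le hp hp0 hf hC.le hfC a hr0 hr1).trans
          (add_le_add_right (mul_le_mul_of_nonneg_left (hmean a ha r hr0 hr1) hC.le) _)
    refine hfin.trans ?_
    -- `p a ≥ δ` turns the additive constant into a multiple of `p a`.
    have h1 : C + C * K ≤ (C + C * K) / δ * beurlingWeight ω a := by
      rw [div_mul_eq_mul_div, le_div_iff₀ hδ]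
      exact mul_le_mul_of_nonneg_left (hδX a a.2) (by positivity)
    linarith
  exact ⟨summable_of_sum_le hnn hsum, Real.tsum_le_of_sum_le hnn hsum⟩
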